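/- **Lemma.** Let $(\mathcal G, Y)$ be a graph of groups: $Y$ is a connected nonempty graph in the sense of Serre (oriented edges $e$ with a fixed-point-free inversion $e\mapsto\bar e$, origin $o(e)$ and terminus $t(e)=o(\bar e)$), with vertex groups $G_v$, edge groups $G_e=G_{\bar e}$ and monomorphisms $\phi_e\colon G_e\to G_{t(e)}$. Let $\pi=\pi(\mathcal G,Y)$ be its fundamental group with respect to a maximal (that is, spanning) tree of $Y$, that is, the group generated by the vertex groups and the edges $y$ of $Y$, subject to the relations $y\,\phi_y(a)\,y^{-1}=\phi_{\bar y}(a)$ and $\bar y=y^{-1}$ for all edges $y$ and all $a\in G_y$, and $y=1$ for the edges $y$ of the maximal tree. Let $i_v\colon G_v\to\pi$ be the natural homomorphisms. Let $G$ be a finite group and let $\chi\colon\pi\to G$ be a storing homomorphism, that is, a surjective homomorphism such that $\chi\circ i_v\colon G_v\to G$ is injective for every vertex $v$ of $Y$. Put $F=\ker\chi$. The group $G\cong\pi/F$ acts on the abelianization $F_{ab}=F/[F,F]$ by the action induced by conjugation in $\pi$: $\chi(\gamma)\cdot[f]=[\gamma f\gamma^{-1}]$ for $\gamma\in\pi$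 and $f\in F$. Let $T$ be the Bass–Serre tree (universal cover) of $(\mathcal G,Y)$: its vertices are the cosets $g\,i_v(G_v)$ with $v$ a vertex of $Y$, its oriented edges are the cosets $g\,i_{t(y)}(\phi_y(G_y))$ with $y$ an oriented edge of $Y$, such an edge runs from $g y^{-1}\,i_{o(y)}(G_{o(y)})$ to $g\,i_{t(y)}(G_{t(y)})$, and its inverse is the coset $g y^{-1}\,i_{o(y)}(\phi_{\bar y}(G_y))$ belonging to $\bar y$. The group $\pi$ acts on $T$ by left multiplication. Let $X=T/F$ be the quotient graph, with the action of $G$ given by $\chi(\gamma)\cdot Fx=F\gamma x$, and let $G$ act on $H_1(X)=H_1(X;\mathbb Z)$ accordingly. Then $F_{ab}$ and $H_1(X)=H_1(T/F)$ are isomorphic as $\mathbb ZG$-modules. -/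

import Mathlib

/-! ### Graphs in the sense of Serre -/

/-- A graph: vertices `V`, oriented edges `E`, a fixed point free involution `bar` on `E` and the
terminus map `t`.  The origin of `e` is `o e = t (bar e)`, see `SerreGraph.o`. -/
structure SerreGraph where
  V : Type*
  E : Type*
  bar : E → E
  bar_bar : ∀ e, bar (bar e) = e
  bar_ne : ∀ e, bar e ≠ e
  t : E → V

namespace SerreGraph

/-- The origin of an oriented edge. -/
def o (X : SerreGraph) (e : X.E) : X.V := X.t (X.bar e)

theorem t_eq_o_bar (X : SerreGraph) (e : X.E) : X.t e = X.o (X.bar e) := by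
  rw [o, X.bar_bar]

/-- `X.IsWalk u p v`: the list `p` of oriented edges is an edge path from `u` to `v`. -/
def IsWalk (X : SerreGraph) : X.V → List X.E → X.V → Prop
  | u, [], v => u = v
  | u, e :: p, v => X.o e = u ∧ X.IsWalk (X.t e) p v

/-- An edge path without backtracking. -/
def IsReduced (X : SerreGraph) (p : List X.E) : Prop :=
  p.IsChain (fun e f => f ≠ X.bar e)

/-- Connected and nonempty. -/
structure IsConnected (X : SerreGraph) : Prop where
  nonempty : Nonempty X.V
  exists_walk : ∀ u v : X.V, ∃ p, X.IsWalk u p v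

/-- A tree: a connected nonempty graph without nontrivial reduced closed edge paths. -/
structure IsTree (X : SerreGraph) : Prop extends X.IsConnected where
  eq_nil : ∀ (v : X.V) (p : List X.E), X.IsWalk v p v → X.IsReduced p → p = []

/-- The subgraph with all the vertices of `X`, and with the edges in `S`. -/
def spanningSubgraph (X : SerreGraph) (S : Set X.E) (hS : ∀ e ∈ S, X.bar e ∈ S) :
    SerreGraph where
  V := X.V
  E := S
  bar e := ⟨X.bar e.1, hS e.1 e.2⟩
  bar_bar e := Subtype.ext (X.bar_bar e.1)
  bar_ne e h := X.bar_ne e.1 (congrArg Subtype.val h)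
  t e := X.t e.1

/-- `S` is the set of edges of a maximal tree of `X`, that is, of a subgraph that is a tree and
contains all the vertices of `X`. -/
def IsMaximalTree (X : SerreGraph) (S : Set X.E) : Prop :=
  ∃ hS : ∀ e ∈ S, X.bar e ∈ S, (X.spanningSubgraph S hS).IsTree

/-- The equivalence relation on oriented edges generated by `e ∼ bar e`. -/
def uSetoid (X : SerreGraph) : Setoid X.E where
  r e f := e = f ∨ e = X.bar f
  iseqv :=
    { refl := fun _ => Or.inl rfl
      symm := by
        rintro e f (h | h)
        · exact Or.inl h.symm
        · exact Or.inr (by rw [h, X.bar_bar])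
      trans := by
        rintro e f g (h | h) (h' | h')
        · exact Or.inl (h.trans h')
        · exact Or.inr (h.trans h')
        · exact Or.inr (by rw [h, h'])
        · exact Or.inl (by rw [h, h', X.bar_bar]) }

/-- The unoriented edges `{e, bar e}`. -/
def UEdge (X : SerreGraph) := Quotient X.uSetoid

/-- The unoriented edge `{e, bar e}` of an oriented edge `e`. -/
def toU (X : SerreGraph) (e : X.E) : X.UEdge := Quotient.mk X.uSetoid e

theorem toU_bar (X : SerreGraph) (e : X.E) : X.toU (X.bar e) = X.toU e :=
  Quotient.sound (s := X.uSetoid) (Or.inr rfl)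

/-- Morphisms of graphs. -/
@[ext]
structure Hom (X X' : SerreGraph) where
  onV : X.V → X'.V
  onE : X.E → X'.E
  map_bar : ∀ e, onE (X.bar e) = X'.bar (onE e)
  map_t : ∀ e, onV (X.t e) = X'.t (onE e)

/-- The endomorphisms of a graph, under composition. -/
instance (X : SerreGraph) : Monoid (Hom X X) where
  mul f g :=
    { onV := f.onV ∘ g.onV
      onE := f.onE ∘ g.onE
      map_bar := fun e => by simp [g.map_bar, f.map_bar]
      map_t := fun e => by simp [g.map_t, f.map_t] }
  one := { onV := id, onE := id, map_bar := fun _ => rfl, map_t := fun _ => rfl }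
  mul_assoc _ _ _ := rfl
  one_mul _ := rfl
  mul_one _ := rfl

@[simp] theorem mul_onV {X : SerreGraph} (f g : Hom X X) (v : X.V) :
    (f * g).onV v = f.onV (g.onV v) := rfl
@[simp] theorem mul_onE {X : SerreGraph} (f g : Hom X X) (e : X.E) :
    (f * g).onE e = f.onE (g.onE e) := rfl
@[simp] theorem one_onV {X : SerreGraph} (v : X.V) : (1 : Hom X X).onV v = v := rfl
@[simp] theorem one_onE {X : SerreGraph} (e : X.E) : (1 : Hom X X).onE e = e := rfl

/-! ### First homology of a graph, from its cellular chain complex `0 → C₁ → C₀` -/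

/-- The relations `e + bar e = 0` between the oriented edges. -/
noncomputable def revRel (X : SerreGraph) : Submodule ℤ (X.E →₀ ℤ) :=
  Submodule.span ℤ
    (Set.range fun e : X.E => Finsupp.single e (1 : ℤ) + Finsupp.single (X.bar e) (1 : ℤ))

/-- The group of cellular `1`-chains: the free abelian group on the oriented edges modulo the
relations `bar e = -e`. -/
abbrev C1 (X : SerreGraph) : Type _ := (X.E →₀ ℤ) ⧸ X.revRel

/-- `e ↦ t e - o e`, on the free abelian group on the oriented edges. -/
noncomputable def preBoundary (X : SerreGraph) : (X.E →₀ ℤ) →ₗ[ℤ] (X.V →₀ ℤ) :=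
  Finsupp.lmapDomain ℤ ℤ X.t - Finsupp.lmapDomain ℤ ℤ X.o

theorem revRel_le_ker (X : SerreGraph) : X.revRel ≤ LinearMap.ker X.preBoundary := by
  refine Submodule.span_le.2 ?_
  rintro _ ⟨e, rfl⟩
  simp only [SetLike.mem_coe, LinearMap.mem_ker, preBoundary, map_add, LinearMap.sub_apply,
    Finsupp.lmapDomain_apply, Finsupp.mapDomain_single, o, X.bar_bar]
  abel

/-- The boundary map `∂ : C₁ → C₀`, `∂ e = t e - o e`, with `C₀` free abelian on the vertices. -/
noncomputable def boundary (X : SerreGraph) : X.C1 →ₗ[ℤ] (X.V →₀ ℤ) :=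
  X.revRel.liftQ X.preBoundary X.revRel_le_ker

/-- `H₁(X)`, the kernel of the boundary map (there are no `2`-cells). -/
noncomputable abbrev H1 (X : SerreGraph) : Submodule ℤ X.C1 := LinearMap.ker X.boundary

theorem revRel_le_comap {X X' : SerreGraph} (f : Hom X X') :
    X.revRel ≤ X'.revRel.comap (Finsupp.lmapDomain ℤ ℤ f.onE) := by
  refine Submodule.span_le.2 ?_
  rintro _ ⟨e, rfl⟩
  simp only [SetLike.mem_coe, Submodule.mem_comap, map_add, Finsupp.lmapDomain_apply,
    Finsupp.mapDomain_single, f.map_bar]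
  exact Submodule.subset_span ⟨f.onE e, rfl⟩

/-- The map on `1`-chains induced by a morphism of graphs. -/
noncomputable def mapC1 {X X' : SerreGraph} (f : Hom X X') : X.C1 →ₗ[ℤ] X'.C1 :=
  X.revRel.mapQ X'.revRel (Finsupp.lmapDomain ℤ ℤ f.onE) (revRel_le_comap f)

theorem boundary_mapC1 {X X' : SerreGraph} (f : Hom X X') (c : X.C1) :
    X'.boundary (mapC1 f c) = Finsupp.lmapDomain ℤ ℤ f.onV (X.boundary c) := by
  have h : X'.boundary ∘ₗ mapC1 f = Finsupp.lmapDomain ℤ ℤ f.onV ∘ₗ X.boundary := by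
    refine Submodule.linearMap_qext _ (Finsupp.lhom_ext' fun e => LinearMap.ext_ring ?_)
    have h1 : (X'.boundary ∘ₗ mapC1 f) (Submodule.Quotient.mk (Finsupp.single e 1)) =
        X'.preBoundary (Finsupp.lmapDomain ℤ ℤ f.onE (Finsupp.single e 1)) := rfl
    have h2 : (Finsupp.lmapDomain ℤ ℤ f.onV ∘ₗ X.boundary)
        (Submodule.Quotient.mk (Finsupp.single e 1)) =
        Finsupp.lmapDomain ℤ ℤ f.onV (X.preBoundary (Finsupp.single e 1)) := rfl
    refine h1.trans (Eq.trans ?_ h2.symm)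
    simp only [preBoundary, LinearMap.sub_apply, map_sub, Finsupp.lmapDomain_apply,
      Finsupp.mapDomain_single, o, f.map_t, f.map_bar]
  exact LinearMap.congr_fun h c

/-- The map on `H₁` induced by a morphism of graphs. -/
noncomputable def mapH1 {X X' : SerreGraph} (f : Hom X X') : X.H1 →ₗ[ℤ] X'.H1 :=
  (mapC1 f).restrict fun c hc => by
    rw [LinearMap.mem_ker] at hc ⊢
    rw [boundary_mapC1, hc, map_zero]

/-- The endomorphisms of a graph act linearly on `H₁`. -/
noncomputable def endH1 (X : SerreGraph) : Hom X X →* Module.End ℤ X.H1 where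
  toFun f := mapH1 f
  map_one' := by
    ext ⟨c, hc⟩
    obtain ⟨c, rfl⟩ := Submodule.Quotient.mk_surjective _ c
    change Submodule.Quotient.mk (Finsupp.mapDomain id c) = _
    rw [Finsupp.mapDomain_id]
    rfl
  map_mul' f g := by
    ext ⟨c, hc⟩
    obtain ⟨c, rfl⟩ := Submodule.Quotient.mk_surjective _ c
    change Submodule.Quotient.mk (Finsupp.mapDomain (f.onE ∘ g.onE) c) = _
    rw [Finsupp.mapDomain_comp]
    rfl

/-! ### Group actions on graphs and quotient graphs

An action of a group `P` on `X` is a homomorphism `a : P →* Hom X X`. -/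

/-- An action without inversions. -/
def WithoutInversions {X : SerreGraph} {P : Type*} [Group P] (a : P →* Hom X X) : Prop :=
  ∀ (p : P) (e : X.E), (a p).onE e ≠ X.bar e

/-- Being in the same `N`-orbit of vertices, for a subgroup `N` of the acting group. -/
def orbV {X : SerreGraph} {P : Type*} [Group P] (a : P →* Hom X X) (N : Subgroup P) :
    Setoid X.V where
  r v w := ∃ n ∈ N, (a n).onV v = w
  iseqv :=
    { refl := fun v => ⟨1, N.one_mem, by simp⟩
      symm := by
        rintro v _ ⟨n, hn, rfl⟩
        exact ⟨n⁻¹, N.inv_mem hn, by rw [← mul_onV, ← map_mul]; simp⟩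
      trans := by
        rintro v _ _ ⟨n, hn, rfl⟩ ⟨m, hm, rfl⟩
        exact ⟨m * n, N.mul_mem hm hn, by simp⟩ }

/-- Being in the same `N`-orbit of oriented edges. -/
def orbE {X : SerreGraph} {P : Type*} [Group P] (a : P →* Hom X X) (N : Subgroup P) :
    Setoid X.E where
  r v w := ∃ n ∈ N, (a n).onE v = w
  iseqv :=
    { refl := fun v => ⟨1, N.one_mem, by simp⟩
      symm := by
        rintro v _ ⟨n, hn, rfl⟩
        exact ⟨n⁻¹, N.inv_mem hn, by rw [← mul_onE, ← map_mul]; simp⟩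
      trans := by
        rintro v _ _ ⟨n, hn, rfl⟩ ⟨m, hm, rfl⟩
        exact ⟨m * n, N.mul_mem hm hn, by simp⟩ }

/-- The quotient graph `X/N`: its vertices and edges are the `N`-orbits of those of `X`. -/
def quot {X : SerreGraph} {P : Type*} [Group P] (a : P →* Hom X X)
    (ha : WithoutInversions a) (N : Subgroup P) : SerreGraph where
  V := Quotient (orbV a N)
  E := Quotient (orbE a N)
  bar := Quotient.map X.bar (by
    rintro e _ ⟨n, hn, rfl⟩
    exact ⟨n, hn, (a n).map_bar e⟩)
  bar_bar := by
    rintro ⟨e⟩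
    exact congrArg (Quotient.mk _) (X.bar_bar e)
  bar_ne := by
    rintro ⟨e⟩ h
    obtain ⟨n, -, hn⟩ := Quotient.exact h
    exact ha n (X.bar e) (by rw [hn, X.bar_bar])
  t := Quotient.map X.t (by
    rintro e _ ⟨n, hn, rfl⟩
    exact ⟨n, hn, (a n).map_t e⟩)

/-- For a normal subgroup `N` of `P`, the action of `P` on `X/N` given by `p • [x] = [p • x]`. -/
def quotAction {X : SerreGraph} {P : Type*} [Group P] (a : P →* Hom X X)
    (ha : WithoutInversions a) (N : Subgroup P) [hN : N.Normal] :
    P →* Hom (quot a ha N) (quot a ha N) where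
  toFun p :=
    { onV := Quotient.map (a p).onV (by
        rintro v _ ⟨n, hn, rfl⟩
        exact ⟨p * n * p⁻¹, hN.conj_mem n hn p, by simp only [← mul_onV, ← map_mul]; simp⟩)
      onE := Quotient.map (a p).onE (by
        rintro v _ ⟨n, hn, rfl⟩
        exact ⟨p * n * p⁻¹, hN.conj_mem n hn p, by simp only [← mul_onE, ← map_mul]; simp⟩)
      map_bar := by
        rintro ⟨e⟩
        exact congrArg (Quotient.mk _) ((a p).map_bar e)
      map_t := by
        rintro ⟨e⟩
        exact congrArg (Quotient.mk _) ((a p).map_t e) }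
  map_one' := by
    refine Hom.ext (funext ?_) (funext ?_)
    · rintro ⟨v⟩
      exact congrArg (Quotient.mk _) (by simp)
    · rintro ⟨e⟩
      exact congrArg (Quotient.mk _) (by simp)
  map_mul' p q := by
    refine Hom.ext (funext ?_) (funext ?_)
    · rintro ⟨v⟩
      exact congrArg (Quotient.mk _) (by simp)
    · rintro ⟨e⟩
      exact congrArg (Quotient.mk _) (by simp)

theorem quotAction_eq_one {X : SerreGraph} {P : Type*} [Group P] (a : P →* Hom X X)
    (ha : WithoutInversions a) (N : Subgroup P) [N.Normal] (n : P) (hn : n ∈ N) :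
    quotAction a ha N n = 1 := by
  refine Hom.ext (funext ?_) (funext ?_)
  · rintro ⟨v⟩
    exact Quotient.sound (s := orbV a N) ⟨n⁻¹, N.inv_mem hn, by rw [← mul_onV, ← map_mul]; simp⟩
  · rintro ⟨e⟩
    exact Quotient.sound (s := orbE a N) ⟨n⁻¹, N.inv_mem hn, by rw [← mul_onE, ← map_mul]; simp⟩

end SerreGraph

/-! ### Graphs of groups, their fundamental groups and their Bass–Serre trees -/

/-- A graph of groups on a connected nonempty graph `Y`.  The edge group `G_e` is `Ge (Y.toU e)`;
so `G_(bar e) = G_e` holds by construction, and an oriented edge `e` gives a monomorphism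
`φ e : G_e → G_(t e)`. -/
structure GraphOfGroups (Y : SerreGraph) where
  connected : Y.IsConnected
  Gv : Y.V → Type*
  [groupGv : ∀ v, Group (Gv v)]
  Ge : Y.UEdge → Type*
  [groupGe : ∀ u, Group (Ge u)]
  /-- `φ e rfl` is the monomorphism of the oriented edge `e`, and `φ (bar e) (Y.toU_bar e)` is that
  of `bar e`, on the same group `G_e`. -/
  φ : ∀ {u : Y.UEdge} (e : Y.E), Y.toU e = u → (Ge u →* Gv (Y.t e))
  φ_injective : ∀ {u : Y.UEdge} (e : Y.E) (h : Y.toU e = u), Function.Injective (φ e h)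

attribute [instance] GraphOfGroups.groupGv GraphOfGroups.groupGe

namespace GraphOfGroups

open Monoid.Coprod in
/-- The relators `(y a^y y⁻¹) (a^(bar y))⁻¹` and `(bar y) y` in the free product of the free group
on the edges and of all the vertex groups. -/
def relators {Y : SerreGraph} (A : GraphOfGroups Y) :
    Set (Monoid.Coprod (FreeGroup Y.E) (Monoid.CoprodI A.Gv)) :=
  {r | ∃ (y : Y.E) (a : A.Ge (Y.toU y)),
      r = inl (FreeGroup.of y) * inr (Monoid.CoprodI.of (A.φ y rfl a)) * (inl (FreeGroup.of y))⁻¹ *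
        (inr (Monoid.CoprodI.of (A.φ (Y.bar y) (Y.toU_bar y) a)))⁻¹} ∪
  {r | ∃ y : Y.E, r = inl (FreeGroup.of (Y.bar y)) * inl (FreeGroup.of y)}

/-- The group `F(𝒢, Y)`. -/
abbrev PathGroup {Y : SerreGraph} (A : GraphOfGroups Y) : Type _ :=
  Monoid.Coprod (FreeGroup Y.E) (Monoid.CoprodI A.Gv) ⧸ Subgroup.normalClosure A.relators

/-- The element of `F(𝒢, Y)` given by an edge. -/
def pathEdge {Y : SerreGraph} (A : GraphOfGroups Y) (y : Y.E) : A.PathGroup :=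
  QuotientGroup.mk' _ (Monoid.Coprod.inl (FreeGroup.of y))

/-- The fundamental group `π(𝒢, Y, S)`, for (the edge set of) a maximal tree `S` of `Y`: the
quotient of `F(𝒢, Y)` by the relations `y = 1` for the edges `y` of `S`. -/
abbrev FundGroup {Y : SerreGraph} (A : GraphOfGroups Y) (S : Set Y.E) : Type _ :=
  A.PathGroup ⧸ Subgroup.normalClosure (A.pathEdge '' S)

/-- The element of the fundamental group given by an edge. -/
def edge {Y : SerreGraph} (A : GraphOfGroups Y) (S : Set Y.E) (y : Y.E) : A.FundGroup S :=
  QuotientGroup.mk' _ (A.pathEdge y)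

/-- The natural homomorphism `i_v` from a vertex group to the fundamental group. -/
def incl {Y : SerreGraph} (A : GraphOfGroups Y) (S : Set Y.E) (v : Y.V) :
    A.Gv v →* A.FundGroup S :=
  (QuotientGroup.mk' _).comp <| (QuotientGroup.mk' _).comp <|
    Monoid.Coprod.inr.comp (Monoid.CoprodI.of (M := A.Gv) (i := v))

theorem edge_bar {Y : SerreGraph} (A : GraphOfGroups Y) (S : Set Y.E) (y : Y.E) :
    A.edge S (Y.bar y) = (A.edge S y)⁻¹ := by
  rw [eq_inv_iff_mul_eq_one]
  have h : A.pathEdge (Y.bar y) * A.pathEdge y = 1 := by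
    rw [pathEdge, pathEdge, ← map_mul]
    exact (QuotientGroup.eq_one_iff _).2 (Subgroup.subset_normalClosure (Or.inr ⟨y, rfl⟩))
  rw [edge, edge, ← map_mul, h, map_one]

theorem edge_conj {Y : SerreGraph} (A : GraphOfGroups Y) (S : Set Y.E) (y : Y.E)
    (a : A.Ge (Y.toU y)) :
    A.edge S y * A.incl S _ (A.φ y rfl a) * (A.edge S y)⁻¹ =
      A.incl S _ (A.φ (Y.bar y) (Y.toU_bar y) a) := by
  rw [← mul_inv_eq_one]
  have h := (QuotientGroup.eq_one_iff (N := Subgroup.normalClosure A.relators) _).2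
    (Subgroup.subset_normalClosure (Or.inl ⟨y, a, rfl⟩))
  exact (congrArg (QuotientGroup.mk' (Subgroup.normalClosure (A.pathEdge '' S))) h).trans
    (map_one _)

/-- The image of the vertex group `G_v` in the fundamental group. -/
def vSub {Y : SerreGraph} (A : GraphOfGroups Y) (S : Set Y.E) (v : Y.V) :
    Subgroup (A.FundGroup S) :=
  (A.incl S v).range

/-- The image of the edge group `G_y` in the fundamental group, under `φ y : G_y → G_(t y)`. -/
def eSub {Y : SerreGraph} (A : GraphOfGroups Y) (S : Set Y.E) (y : Y.E) :
    Subgroup (A.FundGroup S) :=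
  ((A.incl S (Y.t y)).comp (A.φ y rfl)).range

theorem eSub_le {Y : SerreGraph} (A : GraphOfGroups Y) (S : Set Y.E) (y : Y.E) :
    A.eSub S y ≤ A.vSub S (Y.t y) := by
  rintro _ ⟨a, rfl⟩
  exact ⟨_, rfl⟩

theorem φ_mem_eSub {Y : SerreGraph} (A : GraphOfGroups Y) (S : Set Y.E) {u : Y.UEdge} (y : Y.E)
    (h : Y.toU y = u) (a : A.Ge u) : A.incl S (Y.t y) (A.φ y h a) ∈ A.eSub S y := by
  subst h
  exact ⟨a, rfl⟩

theorem conj_mem_eSub {Y : SerreGraph} (A : GraphOfGroups Y) (S : Set Y.E) (y : Y.E)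
    (x : A.FundGroup S) (hx : x ∈ A.eSub S y) :
    A.edge S y * x * (A.edge S y)⁻¹ ∈ A.eSub S (Y.bar y) := by
  obtain ⟨a, rfl⟩ := hx
  rw [MonoidHom.comp_apply, edge_conj]
  exact A.φ_mem_eSub S _ _ a

/-- The Bass–Serre tree of `(𝒢, Y)`.  The vertices over `v` are the cosets `g G_v`, and the edges
over `y` are the cosets `g G_y`, where `G_y ≤ G_(t y)` through `φ y`.  The terminus of the edge
`g G_y` is the vertex `g G_(t y)`, and its inverse edge is the coset `g y⁻¹ G_(bar y)` over `bar y`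
(recall `y G_y y⁻¹ = G_(bar y)` in the fundamental group), so that its origin is the vertex
`g y⁻¹ G_(o y)`. -/
def bassSerreTree {Y : SerreGraph} (A : GraphOfGroups Y) (S : Set Y.E) : SerreGraph where
  V := Σ v : Y.V, A.FundGroup S ⧸ A.vSub S v
  E := Σ y : Y.E, A.FundGroup S ⧸ A.eSub S y
  bar e := ⟨Y.bar e.1, Quotient.map' (fun g => g * (A.edge S e.1)⁻¹) (by
    intro g h hgh
    rw [QuotientGroup.leftRel_apply] at hgh ⊢
    have := A.conj_mem_eSub S e.1 _ hgh
    simpa [mul_assoc] using this) e.2⟩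
  bar_bar := by
    rintro ⟨y, ⟨g⟩⟩
    have key : ∀ z : Y.E, z = y → ∀ h : A.FundGroup S, h = g →
        (⟨z, QuotientGroup.mk h⟩ : Σ y : Y.E, A.FundGroup S ⧸ A.eSub S y) =
          ⟨y, QuotientGroup.mk g⟩ := by
      rintro z rfl h rfl
      rfl
    exact key _ (Y.bar_bar y) (g * (A.edge S y)⁻¹ * (A.edge S (Y.bar y))⁻¹)
      (by rw [edge_bar]; simp)
  bar_ne e h := Y.bar_ne e.1 (congrArg Sigma.fst h)
  t e := ⟨Y.t e.1, Quotient.map' id (by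
    intro g h hgh
    rw [QuotientGroup.leftRel_apply] at hgh ⊢
    exact A.eSub_le S e.1 hgh) e.2⟩

/-- The action of the fundamental group on the Bass–Serre tree, by left multiplication on cosets. -/
def treeAction {Y : SerreGraph} (A : GraphOfGroups Y) (S : Set Y.E) :
    A.FundGroup S →* (A.bassSerreTree S).Hom (A.bassSerreTree S) where
  toFun g :=
    { onV := fun v => ⟨v.1, g • v.2⟩
      onE := fun e => ⟨e.1, g • e.2⟩
      map_bar := by
        rintro ⟨y, ⟨h⟩⟩
        have key : (⟨Y.bar y, QuotientGroup.mk (g * h * (A.edge S y)⁻¹)⟩ :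
            Σ y : Y.E, A.FundGroup S ⧸ A.eSub S y) =
            ⟨Y.bar y, QuotientGroup.mk (g * (h * (A.edge S y)⁻¹))⟩ := by
          rw [mul_assoc]
        exact key.symm
      map_t := by
        rintro ⟨y, ⟨h⟩⟩
        rfl }
  map_one' := by
    refine SerreGraph.Hom.ext (funext ?_) (funext ?_)
    · rintro ⟨v, x⟩
      exact congrArg (Sigma.mk v) (one_smul _ x)
    · rintro ⟨y, x⟩
      exact congrArg (Sigma.mk y) (one_smul _ x)
  map_mul' g h := by
    refine SerreGraph.Hom.ext (funext ?_) (funext ?_)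
    · rintro ⟨v, x⟩
      exact congrArg (Sigma.mk v) (mul_smul g h x)
    · rintro ⟨y, x⟩
      exact congrArg (Sigma.mk y) (mul_smul g h x)

theorem treeAction_withoutInversions {Y : SerreGraph} (A : GraphOfGroups Y) (S : Set Y.E) :
    SerreGraph.WithoutInversions (A.treeAction S) :=
  fun _ e h => Y.bar_ne e.1 (congrArg Sigma.fst h).symm

/-- A storing homomorphism: surjective, and injective on every vertex group. -/
structure IsStoring {Y : SerreGraph} (A : GraphOfGroups Y) {S : Set Y.E} {G : Type*} [Group G]
    (χ : A.FundGroup S →* G) : Prop where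
  surjective : Function.Surjective χ
  injective : ∀ v : Y.V, Function.Injective (χ.comp (A.incl S v))

end GraphOfGroups

/-! ### The two `ℤG`-modules -/

/-- For a surjection `χ : P → G` and a homomorphism `f` on `P` that is trivial on `ker χ`, the
homomorphism on `G` with `χ p ↦ f p`. -/
noncomputable def descend {P G M : Type*} [Group P] [Group G] [Monoid M] (χ : P →* G)
    (hχ : Function.Surjective χ) (f : P →* M) (hf : ∀ p ∈ χ.ker, f p = 1) : G →* M :=
  (QuotientGroup.lift χ.ker f hf).comp
    (QuotientGroup.quotientKerEquivOfSurjective χ hχ).symm.toMonoidHom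

theorem descend_apply {P G M : Type*} [Group P] [Group G] [Monoid M] (χ : P →* G)
    (hχ : Function.Surjective χ) (f : P →* M) (hf : ∀ p ∈ χ.ker, f p = 1) (p : P) :
    descend χ hχ f hf (χ p) = f p := by
  have h : (QuotientGroup.quotientKerEquivOfSurjective χ hχ).symm (χ p) = (p : P ⧸ χ.ker) :=
    (MulEquiv.symm_apply_eq _).2 rfl
  change QuotientGroup.lift χ.ker f hf
    ((QuotientGroup.quotientKerEquivOfSurjective χ hχ).symm (χ p)) = f p
  rw [h]
  rfl

/-- The action of `P` on the abelianization of a normal subgroup `N` by conjugation,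
`p • [n] = [p n p⁻¹]`. -/
def conjAb {P : Type*} [Group P] (N : Subgroup P) [N.Normal] :
    Representation ℤ P (Additive (Abelianization N)) where
  toFun p := (MonoidHom.toAdditive
    (Abelianization.map (MulAut.conjNormal (H := N) p).toMonoidHom)).toIntLinearMap
  map_one' := by
    have h : (MulAut.conjNormal (H := N) (1 : P)).toMonoidHom = MonoidHom.id N := by
      ext n
      simp
    rw [h, Abelianization.map_id]
    rfl
  map_mul' p q := by
    have h : (MulAut.conjNormal (H := N) (p * q)).toMonoidHom =
        (MulAut.conjNormal (H := N) p).toMonoidHom.comp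
          (MulAut.conjNormal (H := N) q).toMonoidHom := by
      ext n
      simp
    rw [h, ← Abelianization.map_comp]
    rfl

theorem conjAb_eq_one {P : Type*} [Group P] (N : Subgroup P) [N.Normal] (n : P) (hn : n ∈ N) :
    conjAb N n = 1 := by
  have h : Abelianization.map (MulAut.conjNormal (H := N) n).toMonoidHom =
      MonoidHom.id (Abelianization N) := by
    refine Abelianization.hom_ext _ _ (MonoidHom.ext fun x => ?_)
    have hx : (MulAut.conjNormal (H := N) n).toMonoidHom x = ⟨n, hn⟩ * x * ⟨n, hn⟩⁻¹ := by
      ext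
      simp
    change Abelianization.of ((MulAut.conjNormal (H := N) n).toMonoidHom x) = Abelianization.of x
    rw [hx, map_mul, map_mul, map_inv, mul_inv_cancel_comm]
  change (MonoidHom.toAdditive
    (Abelianization.map (MulAut.conjNormal (H := N) n).toMonoidHom)).toIntLinearMap = _
  rw [h]
  rfl

/-- The `G`-action on `F_ab`, `F = ker χ`, induced by conjugation: `χ γ • [f] = [γ f γ⁻¹]`. -/
noncomputable def kerAbRep {P G : Type*} [Group P] [Group G] (χ : P →* G)
    (hχ : Function.Surjective χ) : Representation ℤ G (Additive (Abelianization χ.ker)) :=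
  descend χ hχ (conjAb χ.ker) (conjAb_eq_one χ.ker)

namespace GraphOfGroups

/-- The quotient graph `X = T/F` of the Bass–Serre tree `T` by `F = ker χ`. -/
abbrev quotientGraph {Y : SerreGraph} (A : GraphOfGroups Y) {S : Set Y.E} {G : Type*} [Group G]
    (χ : A.FundGroup S →* G) : SerreGraph :=
  SerreGraph.quot (A.treeAction S) (A.treeAction_withoutInversions S) χ.ker

/-- The `G`-action on `X = T/F` induced by the action of the fundamental group on `T`:
`χ γ • [x] = [γ • x]`. -/
noncomputable def quotientAction {Y : SerreGraph} (A : GraphOfGroups Y) {S : Set Y.E} {G : Type*}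
    [Group G] (χ : A.FundGroup S →* G) (hχ : Function.Surjective χ) :
    G →* (A.quotientGraph χ).Hom (A.quotientGraph χ) :=
  descend χ hχ
    (SerreGraph.quotAction (A.treeAction S) (A.treeAction_withoutInversions S) χ.ker)
    (SerreGraph.quotAction_eq_one (A.treeAction S) (A.treeAction_withoutInversions S) χ.ker)

/-- The induced `G`-action on `H₁(T/F)`. -/
noncomputable def h1Rep {Y : SerreGraph} (A : GraphOfGroups Y) {S : Set Y.E} {G : Type*}
    [Group G] (χ : A.FundGroup S →* G) (hχ : Function.Surjective χ) :
    Representation ℤ G (A.quotientGraph χ).H1 :=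
  (A.quotientGraph χ).endH1.comp (A.quotientAction χ hχ)

end GraphOfGroups

/-! Since `χ` is injective on the vertex groups, `F = ker χ` meets every vertex stabilizer of `T`
trivially and acts freely on vertices; topologically, `F` is then the group of deck transformations
of `T → T/F`, so `F_ab = H₁(T/F)`. The argument is carried out on chains.

All that is needed of `T` is connectedness (`bassSerreTree_propagates`) and a potential: a function
`b` from vertices to `1`-chains with `b (t e) - b (o e) = [e]` (`exists_potential`). One thinks of
`b x` as a path from a base point to `x`. Sending `n ∈ F` to the image of `b (n x) - b x` gives
`F_ab → H₁(T/F)`. Its inverse is the voltage: label each vertex by the element of `F` that carries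
the chosen orbit representative to it, and send an edge to the difference of the labels of its ends.

The potential comes from the presentation of `π`, not from normal forms. A potential `c` along the
maximal tree prescribes a crossed homomorphism `d : π → C₁(T)` on generators, and the relations of
`π` are what makes it well defined (`exists_crossedHom`). Then `b (γ G_v) = d γ + γ c_v`. -/

namespace SerreGraph

/-! ### Cellular chains of a graph -/

/-- The class of an oriented edge in the group of cellular `1`-chains. -/
noncomputable def edgeClass (X : SerreGraph) (e : X.E) : X.C1 :=
  Submodule.Quotient.mk (Finsupp.single e 1)

theorem edgeClass_bar (X : SerreGraph) (e : X.E) :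
    X.edgeClass (X.bar e) = -X.edgeClass e := by
  rw [eq_neg_iff_add_eq_zero, add_comm]
  exact (Submodule.Quotient.mk_eq_zero _).2 (Submodule.subset_span ⟨e, rfl⟩)

theorem boundary_edgeClass (X : SerreGraph) (e : X.E) :
    X.boundary (X.edgeClass e) = Finsupp.single (X.t e) 1 - Finsupp.single (X.o e) 1 := by
  change X.preBoundary (Finsupp.single e 1) = _
  simp [preBoundary]

theorem mapC1_edgeClass {X X' : SerreGraph} (f : Hom X X') (e : X.E) :
    mapC1 f (X.edgeClass e) = X'.edgeClass (f.onE e) := by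
  change Submodule.Quotient.mk (Finsupp.mapDomain f.onE (Finsupp.single e 1)) = _
  rw [Finsupp.mapDomain_single]
  rfl

theorem C1_hom_ext {X : SerreGraph} {M : Type*} [AddCommGroup M] {f g : X.C1 →ₗ[ℤ] M}
    (h : ∀ e, f (X.edgeClass e) = g (X.edgeClass e)) : f = g :=
  Submodule.linearMap_qext _ (Finsupp.lhom_ext' fun e => LinearMap.ext_ring (h e))

/-- The homomorphism on `1`-chains given by an odd function on the oriented edges. -/
noncomputable def liftC1 (X : SerreGraph) {M : Type*} [AddCommGroup M] (f : X.E → M)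
    (hf : ∀ e, f (X.bar e) = -f e) : X.C1 →ₗ[ℤ] M :=
  X.revRel.liftQ (Finsupp.linearCombination ℤ f) <| by
    refine Submodule.span_le.2 ?_
    rintro _ ⟨e, rfl⟩
    simp [hf]

theorem liftC1_edgeClass (X : SerreGraph) {M : Type*} [AddCommGroup M] (f : X.E → M)
    (hf : ∀ e, f (X.bar e) = -f e) (e : X.E) : X.liftC1 f hf (X.edgeClass e) = f e := by
  change Finsupp.linearCombination ℤ f (Finsupp.single e 1) = _
  simp

/-- The endomorphisms of a graph act linearly on the `1`-chains. -/
noncomputable def endC1 (X : SerreGraph) : Hom X X →* Module.End ℤ X.C1 where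
  toFun f := mapC1 f
  map_one' := C1_hom_ext fun e => by rw [mapC1_edgeClass]; rfl
  map_mul' f g := C1_hom_ext fun e => by
    rw [mapC1_edgeClass, Module.End.mul_apply, mapC1_edgeClass, mapC1_edgeClass]; rfl

theorem endC1_edgeClass (X : SerreGraph) (f : Hom X X) (e : X.E) :
    X.endC1 f (X.edgeClass e) = X.edgeClass (f.onE e) := mapC1_edgeClass f e

theorem Hom.map_o {X X' : SerreGraph} (f : Hom X X') (e : X.E) :
    f.onV (X.o e) = X'.o (f.onE e) := by
  rw [o, f.map_t, f.map_bar, o]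

/-- Properties of vertices that pass from origins to termini of edges hold everywhere as soon as
they hold at one vertex. -/
def Propagates (X : SerreGraph) : Prop :=
  ∀ p : X.V → Prop, (∀ e, p (X.o e) → p (X.t e)) → ∀ u v, p u → p v

theorem IsConnected.propagates {X : SerreGraph} (hX : X.IsConnected) : X.Propagates := by
  intro p hp u v hu
  obtain ⟨w, hw⟩ := hX.exists_walk u v
  induction w generalizing u with
  | nil => exact (show u = v from hw) ▸ hu
  | cons e w ih => exact ih (X.t e) (hp e (hw.1.symm ▸ hu)) hw.2

/-- The working form of connectedness: every identity between potentials below is proved by checking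
that some function of a vertex does not change along an edge. -/
theorem Propagates.eq_of_forall_edge {X : SerreGraph} (hX : X.Propagates) {B : Type*}
    (f : X.V → B) (hf : ∀ e, f (X.t e) = f (X.o e)) (u v : X.V) : f u = f v :=
  hX (fun w => f u = f w) (fun e h => h.trans (hf e).symm) u v rfl

/-- The projection to a quotient graph. -/
def quotHom {X : SerreGraph} {P : Type*} [Group P] (a : P →* Hom X X)
    (ha : WithoutInversions a) (N : Subgroup P) : Hom X (quot a ha N) where
  onV := Quotient.mk (orbV a N)
  onE := Quotient.mk (orbE a N)
  map_bar _ := rfl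
  map_t _ := rfl

end SerreGraph

/-! ### Free quotients of connected graphs with a potential -/

section FreeQuotient

open SerreGraph

variable {P : Type*} [Group P] {T : SerreGraph} (a : P →* Hom T T)
  (ha : WithoutInversions a)

/-! ### Vertex labels and voltages for a free action. -/

section FreeAction

variable (N : Subgroup P)

theorem exists_mem_smul_out (x : T.V) :
    ∃ n ∈ N, (a n).onV (Quotient.out (Quotient.mk (orbV a N) x)) = x :=
  Quotient.exact (s := orbV a N) (Quotient.out_eq (Quotient.mk (orbV a N) x))

/-- The element of `N` carrying the chosen representative of the orbit of `x` to `x`. -/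
noncomputable def orbitLabel (x : T.V) : N :=
  ⟨(exists_mem_smul_out a N x).choose, (exists_mem_smul_out a N x).choose_spec.1⟩

theorem orbitLabel_spec (x : T.V) :
    (a (orbitLabel a N x)).onV (Quotient.out (Quotient.mk (orbV a N) x)) = x :=
  (exists_mem_smul_out a N x).choose_spec.2

theorem eq_of_onV_eq (hfree : ∀ n ∈ N, ∀ x, (a n).onV x = x → n = 1) (m n : N) (x : T.V)
    (h : (a m).onV x = (a n).onV x) : m = n := by
  have h1 : (n : P)⁻¹ * m = 1 := by
    refine hfree _ (N.mul_mem (N.inv_mem n.2) m.2) x ?_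
    rw [map_mul, mul_onV, h, ← mul_onV, ← map_mul]
    simp
  exact Subtype.ext (inv_mul_eq_one.1 h1).symm

theorem mk_onV (n : N) (x : T.V) :
    Quotient.mk (orbV a N) ((a n).onV x) = Quotient.mk (orbV a N) x :=
  Quotient.sound (s := orbV a N)
    ⟨(n : P)⁻¹, N.inv_mem n.2, by rw [← mul_onV, ← map_mul]; simp⟩

/-- Both sides carry the representative of the orbit to `n x`, and freeness leaves only one such
element. -/
theorem orbitLabel_onV (hfree : ∀ n ∈ N, ∀ x, (a n).onV x = x → n = 1) (n : N) (x : T.V) :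
    orbitLabel a N ((a n).onV x) = n * orbitLabel a N x := by
  refine eq_of_onV_eq a N hfree _ _ (Quotient.out (Quotient.mk (orbV a N) x)) ?_
  have h := orbitLabel_spec a N ((a n).onV x)
  rw [mk_onV] at h
  rw [h, Subgroup.coe_mul, map_mul, mul_onV, orbitLabel_spec]

/-- The class of the label of a vertex in the abelianization. -/
noncomputable def abLabel (x : T.V) : Additive (Abelianization N) :=
  Additive.ofMul (Abelianization.of (orbitLabel a N x))

theorem abLabel_onV (hfree : ∀ n ∈ N, ∀ x, (a n).onV x = x → n = 1) (n : N) (x : T.V) :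
    abLabel a N ((a n).onV x) = Additive.ofMul (Abelianization.of n) + abLabel a N x := by
  rw [abLabel, orbitLabel_onV a N hfree, map_mul]
  rfl

/-- The voltage of an edge of the quotient graph: the difference of the labels of the ends of a
lift. -/
noncomputable def edgeVoltage (hfree : ∀ n ∈ N, ∀ x, (a n).onV x = x → n = 1) :
    (quot a ha N).E → Additive (Abelianization N) :=
  Quotient.lift (s := orbE a N) (fun e => abLabel a N (T.t e) - abLabel a N (T.o e)) (by
    rintro e _ ⟨n, hn, rfl⟩
    rw [← (a n).map_t, ← (a n).map_o, abLabel_onV a N hfree ⟨n, hn⟩,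
      abLabel_onV a N hfree ⟨n, hn⟩]
    abel)

/-- The total voltage of a `1`-chain of the quotient graph. -/
noncomputable def voltage (hfree : ∀ n ∈ N, ∀ x, (a n).onV x = x → n = 1) :
    (quot a ha N).C1 →ₗ[ℤ] Additive (Abelianization N) :=
  (quot a ha N).liftC1 (edgeVoltage a ha N hfree) (by
    rintro ⟨e⟩
    change abLabel a N (T.t (T.bar e)) - abLabel a N (T.o (T.bar e)) =
      -(abLabel a N (T.t e) - abLabel a N (T.o e))
    rw [← T.t_eq_o_bar, neg_sub]
    rfl)

theorem voltage_edgeClass (hfree : ∀ n ∈ N, ∀ x, (a n).onV x = x → n = 1) (e : T.E) :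
    voltage a ha N hfree ((quot a ha N).edgeClass ((quotHom a ha N).onE e)) =
      abLabel a N (T.t e) - abLabel a N (T.o e) :=
  liftC1_edgeClass _ _ _ _

end FreeAction

/-! ### Comparison of `N_ab` with `H₁(T/N)` by means of a potential. -/

section Potential

variable (N : Subgroup P) (b : T.V → T.C1)
  (hb : ∀ e, b (T.t e) - b (T.o e) = T.edgeClass e) (hT : T.Propagates)

/-- The image of a potential in the `1`-chains of the quotient graph. -/
noncomputable def quotPotential (x : T.V) : (quot a ha N).C1 := mapC1 (quotHom a ha N) (b x)

include hb in
theorem quotPotential_edge (e : T.E) :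
    quotPotential a ha N b (T.t e) - quotPotential a ha N b (T.o e) =
      (quot a ha N).edgeClass ((quotHom a ha N).onE e) := by
  rw [quotPotential, quotPotential, ← map_sub, hb, mapC1_edgeClass]

-- Along an edge, the boundary of the potential and the vertex itself both change by `t e - o e`.
-- Hence `b x - b y` has the boundary of a path from `y` to `x`.
include hb hT in
theorem boundary_quotPotential_sub (x y : T.V) :
    (quot a ha N).boundary (quotPotential a ha N b x) -
        Finsupp.single ((quotHom a ha N).onV x) 1 =
      (quot a ha N).boundary (quotPotential a ha N b y) -
        Finsupp.single ((quotHom a ha N).onV y) 1 := by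
  refine hT.eq_of_forall_edge (fun x => (quot a ha N).boundary (quotPotential a ha N b x) -
        Finsupp.single ((quotHom a ha N).onV x) 1) (fun e => ?_) x y
  rw [sub_eq_sub_iff_sub_eq_sub, ← map_sub, quotPotential_edge a ha N b hb, boundary_edgeClass,
    Hom.map_t, Hom.map_o]

variable (hfree : ∀ n ∈ N, ∀ x, (a n).onV x = x → n = 1)

include hb hT in
theorem voltage_quotPotential_sub (x y : T.V) :
    voltage a ha N hfree (quotPotential a ha N b x - quotPotential a ha N b y) =
      abLabel a N x - abLabel a N y := by
  rw [map_sub, sub_eq_sub_iff_sub_eq_sub]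
  refine hT.eq_of_forall_edge (fun x => voltage a ha N hfree (quotPotential a ha N b x) -
    abLabel a N x) (fun e => ?_) x y
  rw [sub_eq_sub_iff_sub_eq_sub, ← map_sub, quotPotential_edge a ha N b hb, voltage_edgeClass]

variable [N.Normal]

-- The potential need not be equivariant, but its differences are: `x ↦ b (p x)` and `x ↦ p (b x)`
-- have the same increments along edges.
include hb hT in
theorem quotPotential_onV_sub (p : P) (x y : T.V) :
    quotPotential a ha N b ((a p).onV x) - quotPotential a ha N b ((a p).onV y) =
      endC1 _ (quotAction a ha N p) (quotPotential a ha N b x - quotPotential a ha N b y) := by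
  rw [map_sub, sub_eq_sub_iff_sub_eq_sub]
  refine hT.eq_of_forall_edge (fun x => quotPotential a ha N b ((a p).onV x) -
    endC1 _ (quotAction a ha N p) (quotPotential a ha N b x)) (fun e => ?_) x y
  rw [sub_eq_sub_iff_sub_eq_sub, ← map_sub, quotPotential_edge a ha N b hb, (a p).map_t,
    (a p).map_o, quotPotential_edge a ha N b hb, endC1_edgeClass]
  rfl

-- Elements of `N` act trivially on the chains of `T/N`, so the class of a path from `x` to `n x`
-- does not depend on `x`. Additivity and equivariance of `pathLinear` both rest on this.
include hb hT in
theorem quotPotential_mem_sub (n : N) (x y : T.V) :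
    quotPotential a ha N b ((a n).onV x) - quotPotential a ha N b x =
      quotPotential a ha N b ((a n).onV y) - quotPotential a ha N b y := by
  have h := quotPotential_onV_sub a ha N b hb hT n x y
  rw [quotAction_eq_one a ha N n n.2, map_one, Module.End.one_apply] at h
  rwa [sub_eq_sub_iff_sub_eq_sub]

/-- The class in `H₁(T/N)` of the image of a path from `x` to `n x`. -/
noncomputable def pathClass (x : T.V) : Abelianization N →* Multiplicative (quot a ha N).H1 :=
  Abelianization.lift
    { toFun := fun n => Multiplicative.ofAdd
        ⟨quotPotential a ha N b ((a n).onV x) - quotPotential a ha N b x, by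
          rw [LinearMap.mem_ker, map_sub]
          have h := boundary_quotPotential_sub a ha N b hb hT ((a n).onV x) x
          rw [sub_eq_sub_iff_sub_eq_sub] at h
          rw [h, sub_eq_zero]
          exact congrArg (fun v => Finsupp.single v 1) (mk_onV a N n x)⟩
      map_one' := by
        refine Subtype.ext ?_
        change quotPotential a ha N b ((a ((1 : N) : P)).onV x) - quotPotential a ha N b x = 0
        simp
      -- A path from `x` to `m n x` is cut at `n x`; its second piece may be moved back to start at
      -- `x`.
      map_mul' := fun m n => by
        refine Subtype.ext ?_
        change quotPotential a ha N b ((a ((m * n : N) : P)).onV x) - quotPotential a ha N b x =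
          (quotPotential a ha N b ((a m).onV x) - quotPotential a ha N b x) +
          (quotPotential a ha N b ((a n).onV x) - quotPotential a ha N b x)
        rw [quotPotential_mem_sub a ha N b hb hT m x ((a n).onV x), Subgroup.coe_mul, map_mul,
          mul_onV]
        abel }

/-- `pathClass` as a linear map. -/
noncomputable def pathLinear (x : T.V) :
    Additive (Abelianization N) →ₗ[ℤ] (quot a ha N).H1 :=
  (MonoidHom.toAdditiveLeft (pathClass a ha N b hb hT x)).toIntLinearMap

theorem pathLinear_of (x y : T.V) (n : N) :
    (pathLinear a ha N b hb hT x (Additive.ofMul (Abelianization.of n)) : (quot a ha N).C1) =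
      quotPotential a ha N b ((a n).onV y) - quotPotential a ha N b y :=
  quotPotential_mem_sub a ha N b hb hT n x y

theorem additive_abelianization_induction {N : Type*} [Group N]
    {p : Additive (Abelianization N) → Prop}
    (h : ∀ n : N, p (Additive.ofMul (Abelianization.of n))) (z : Additive (Abelianization N)) :
    p z := by
  obtain ⟨n, rfl⟩ := QuotientGroup.mk_surjective z.toMul
  exact h n

theorem pathLinear_conjAb (x : T.V) (p : P) (z : Additive (Abelianization N)) :
    pathLinear a ha N b hb hT x (conjAb N p z) =
      endH1 _ (quotAction a ha N p) (pathLinear a ha N b hb hT x z) := by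
  induction z using additive_abelianization_induction with
  | h n =>
    refine Subtype.ext ?_
    have h1 : conjAb N p (Additive.ofMul (Abelianization.of n)) =
        Additive.ofMul (Abelianization.of (MulAut.conjNormal p n)) := rfl
    -- With base point `p x`, the element `p n p⁻¹` leads to `p n x`, so the path is the
    -- `p`-translate of the one from `x` to `n x`.
    rw [h1, pathLinear_of a ha N b hb hT x ((a p).onV x)]
    change _ = endC1 _ (quotAction a ha N p)
      (pathLinear a ha N b hb hT x (Additive.ofMul (Abelianization.of n)) : (quot a ha N).C1)
    rw [pathLinear_of a ha N b hb hT x x, ← quotPotential_onV_sub a ha N b hb hT]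
    simp [← mul_onV, ← map_mul]

theorem voltage_pathLinear (x : T.V) (z : Additive (Abelianization N)) :
    voltage a ha N hfree (pathLinear a ha N b hb hT x z) = z := by
  induction z using additive_abelianization_induction with
  | h n =>
    rw [pathLinear_of a ha N b hb hT x x, voltage_quotPotential_sub a ha N b hb hT,
      abLabel_onV a N hfree, add_sub_cancel_right]

theorem pathLinear_voltage (x : T.V) (c : (quot a ha N).H1) :
    pathLinear a ha N b hb hT x (voltage a ha N hfree c) = c := by
  -- `β` is a contracting homotopy up to voltage: the identity on chains is the path of the voltage
  -- plus `β ∂`, and the second term vanishes on cycles.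
  let β : ((quot a ha N).V →₀ ℤ) →ₗ[ℤ] (quot a ha N).C1 :=
    Finsupp.linearCombination ℤ fun v => quotPotential a ha N b (Quotient.out v)
  have hβ : ∀ v, β (Finsupp.single v 1) = quotPotential a ha N b (Quotient.out v) := fun v => by
    simp only [β, Finsupp.linearCombination_single, one_smul]
  -- The label of `y` leads from the orbit representative to `y`, so its path class can be computed
  -- with that representative as base point.
  have hlab : ∀ y, (pathLinear a ha N b hb hT x (abLabel a N y) : (quot a ha N).C1) =
      quotPotential a ha N b y -
        quotPotential a ha N b (Quotient.out (Quotient.mk (orbV a N) y)) := by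
    intro y
    rw [abLabel, pathLinear_of a ha N b hb hT x (Quotient.out (Quotient.mk (orbV a N) y)),
      orbitLabel_spec]
  have key : (Submodule.subtype _ ∘ₗ pathLinear a ha N b hb hT x) ∘ₗ voltage a ha N hfree +
      β ∘ₗ (quot a ha N).boundary = LinearMap.id := by
    refine C1_hom_ext ?_
    rintro ⟨e⟩
    change (pathLinear a ha N b hb hT x (voltage a ha N hfree
      ((quot a ha N).edgeClass ((quotHom a ha N).onE e))) : (quot a ha N).C1) +
      β ((quot a ha N).boundary ((quot a ha N).edgeClass ((quotHom a ha N).onE e))) =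
      (quot a ha N).edgeClass ((quotHom a ha N).onE e)
    rw [voltage_edgeClass, boundary_edgeClass, map_sub, map_sub β, hβ, hβ, AddSubgroupClass.coe_sub, hlab,
      hlab, ← quotPotential_edge a ha N b hb, ← Hom.map_t, ← Hom.map_o]
    simp only [quotHom]
    abel
  refine Subtype.ext ?_
  have h := LinearMap.congr_fun key (c : (quot a ha N).C1)
  have hc : (quot a ha N).boundary (c : (quot a ha N).C1) = 0 := c.2
  rw [LinearMap.add_apply, LinearMap.comp_apply β, hc, map_zero, add_zero] at h
  exact h

/-- If `N` acts freely on the vertices of a connected graph `T` with a potential, then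
`N_ab` is isomorphic to `H₁(T/N)`. -/
noncomputable def abelianizationEquivH1 (x : T.V) :
    Additive (Abelianization N) ≃ₗ[ℤ] (quot a ha N).H1 :=
  { pathLinear a ha N b hb hT x with
    invFun := fun c => voltage a ha N hfree c
    left_inv := voltage_pathLinear a ha N b hb hT hfree x
    right_inv := pathLinear_voltage a ha N b hb hT hfree x }

end Potential

end FreeQuotient

namespace SerreGraph

/-! ### Potentials on trees -/

theorem isWalk_append (X : SerreGraph) (p q : List X.E) (u v : X.V) :
    X.IsWalk u (p ++ q) v ↔ ∃ w, X.IsWalk u p w ∧ X.IsWalk w q v := by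
  induction p generalizing u with
  | nil => simp [IsWalk]
  | cons e p ih => simp [IsWalk, ih, and_assoc]

/-- In a tree, an odd function on the oriented edges has sum zero along closed walks. -/
theorem IsTree.sum_eq_zero {X : SerreGraph} (hX : X.IsTree) {M : Type*} [AddCommGroup M]
    (f : X.E → M) (hf : ∀ e, f (X.bar e) = -f e) (n : ℕ) :
    ∀ (p : List X.E) (v : X.V), p.length = n → X.IsWalk v p v → (p.map f).sum = 0 := by
  induction n using Nat.strong_induction_on with
  | _ n ih =>
    intro p v hn hp
    by_cases hr : X.IsReduced p
    · rw [hX.eq_nil v p hp hr]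
      rfl
    · rw [IsReduced, List.isChain_iff_forall_rel_of_append_cons_cons] at hr
      push Not at hr
      -- A walk that is not reduced contains some `e, bar e`; deleting the pair shortens the walk
      -- and, `f` being odd, keeps the sum.
      obtain ⟨e, e', q, r, rfl, rfl⟩ := hr
      obtain ⟨x, hq, rfl, hx, hr⟩ := (X.isWalk_append _ _ _ _).1 hp
      have h := ih (q ++ r).length (by rw [← hn]; simp) (q ++ r) v rfl
        ((X.isWalk_append _ _ _ _).2 ⟨_, hq, hr⟩)
      simp only [List.map_append, List.sum_append, List.map_cons, List.sum_cons, hf] at h ⊢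
      rw [add_neg_cancel_left, h]

/-- An odd function on the oriented edges of a tree is the difference of the values of a function
at the ends. -/
theorem IsTree.exists_potential {X : SerreGraph} (hX : X.IsTree) {M : Type*} [AddCommGroup M]
    (f : X.E → M) (hf : ∀ e, f (X.bar e) = -f e) :
    ∃ c : X.V → M, ∀ e, c (X.t e) - c (X.o e) = f e := by
  obtain ⟨v₀⟩ := hX.nonempty
  choose w hw using hX.exists_walk v₀
  have hrev : ∀ (p : List X.E) (u v : X.V), X.IsWalk u p v →
      ∃ q, X.IsWalk v q u ∧ (q.map f).sum = -(p.map f).sum := by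
    intro p
    induction p with
    | nil => exact fun u v h => ⟨[], Eq.symm h, by simp⟩
    | cons e p ih =>
      rintro u v ⟨rfl, h⟩
      obtain ⟨q, hq, hs⟩ := ih _ _ h
      refine ⟨q ++ [X.bar e], (X.isWalk_append _ _ _ _).2 ⟨_, hq, (X.t_eq_o_bar e).symm, rfl⟩, ?_⟩
      simp [hs, hf]
  refine ⟨fun v => ((w v).map f).sum, fun e => ?_⟩
  obtain ⟨q, hq, hs⟩ := hrev _ _ _ (hw (X.t e))
  have h := hX.sum_eq_zero f hf _ (w (X.o e) ++ e :: q) v₀ rfl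
    ((X.isWalk_append _ _ _ _).2 ⟨_, hw _, rfl, hq⟩)
  simp only [List.map_append, List.sum_append, List.map_cons, List.sum_cons, hs] at h
  rw [← add_assoc, ← sub_eq_add_neg, sub_eq_zero] at h
  exact sub_eq_iff_eq_add'.2 h.symm

end SerreGraph

/-! ### Semidirect products and crossed homomorphisms -/

/-- The action of `P` by automorphisms on the multiplicative copy of a representation. -/
def mulAutOfRep {P M : Type*} [Group P] [AddCommGroup M] (ρ : P →* Module.End ℤ M) :
    P →* MulAut (Multiplicative M) where
  toFun p :=
    { toFun := fun m => Multiplicative.ofAdd (ρ p m.toAdd)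
      invFun := fun m => Multiplicative.ofAdd (ρ p⁻¹ m.toAdd)
      left_inv := fun m => by
        change Multiplicative.ofAdd (ρ p⁻¹ (ρ p m.toAdd)) = m
        rw [← Module.End.mul_apply, ← map_mul, inv_mul_cancel, map_one]
        rfl
      right_inv := fun m => by
        change Multiplicative.ofAdd (ρ p (ρ p⁻¹ m.toAdd)) = m
        rw [← Module.End.mul_apply, ← map_mul, mul_inv_cancel, map_one]
        rfl
      map_mul' := fun m n => congrArg Multiplicative.ofAdd (map_add (ρ p) m.toAdd n.toAdd) }
  map_one' := by
    ext m
    change Multiplicative.ofAdd (ρ 1 m.toAdd) = m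
    rw [map_one]
    rfl
  map_mul' p q := by
    ext m
    change Multiplicative.ofAdd (ρ (p * q) m.toAdd) = Multiplicative.ofAdd (ρ p (ρ q m.toAdd))
    rw [map_mul]
    rfl

namespace GraphOfGroups

variable {Y : SerreGraph} (A : GraphOfGroups Y) (S : Set Y.E)

/-! ### The universal property of the fundamental group -/

/-- The homomorphism on the fundamental group given by values on the generators that satisfy the
relations. -/
def liftFund {H : Type*} [Group H] (f : ∀ v, A.Gv v →* H) (g : Y.E → H)
    (hconj : ∀ y (a : A.Ge (Y.toU y)),
      g y * f _ (A.φ y rfl a) * (g y)⁻¹ = f _ (A.φ (Y.bar y) (Y.toU_bar y) a))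
    (hbar : ∀ y, g (Y.bar y) * g y = 1) (hS : ∀ y ∈ S, g y = 1) : A.FundGroup S →* H :=
  QuotientGroup.lift _
    (QuotientGroup.lift _ (Monoid.Coprod.lift (FreeGroup.lift g) (Monoid.CoprodI.lift f)) <| by
      refine fun x hx => MonoidHom.mem_ker.1 (Subgroup.normalClosure_le_normal ?_ hx)
      rintro _ (⟨y, a, rfl⟩ | ⟨y, rfl⟩)
      · simp [MonoidHom.mem_ker, hconj]
      · simp [MonoidHom.mem_ker, hbar]) <| by
    refine fun x hx => MonoidHom.mem_ker.1 (Subgroup.normalClosure_le_normal ?_ hx)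
    rintro _ ⟨y, hy, rfl⟩
    change Monoid.Coprod.lift (FreeGroup.lift g) (Monoid.CoprodI.lift f)
      (Monoid.Coprod.inl (FreeGroup.of y)) = 1
    simp [hS y hy]

section
variable {H : Type*} [Group H] (f : ∀ v, A.Gv v →* H) (g : Y.E → H)
    (hconj : ∀ y (a : A.Ge (Y.toU y)),
      g y * f _ (A.φ y rfl a) * (g y)⁻¹ = f _ (A.φ (Y.bar y) (Y.toU_bar y) a))
    (hbar : ∀ y, g (Y.bar y) * g y = 1) (hS : ∀ y ∈ S, g y = 1)

theorem liftFund_incl (v : Y.V) (x : A.Gv v) :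
    A.liftFund S f g hconj hbar hS (A.incl S v x) = f v x := by
  change Monoid.Coprod.lift (FreeGroup.lift g) (Monoid.CoprodI.lift f)
    (Monoid.Coprod.inr (Monoid.CoprodI.of x)) = _
  simp

theorem liftFund_edge (y : Y.E) :
    A.liftFund S f g hconj hbar hS (A.edge S y) = g y := by
  change Monoid.Coprod.lift (FreeGroup.lift g) (Monoid.CoprodI.lift f)
    (Monoid.Coprod.inl (FreeGroup.of y)) = _
  simp
end

variable {A S}

theorem fundGroup_hom_ext {H : Type*} [Group H] {f g : A.FundGroup S →* H}
    (hv : ∀ v x, f (A.incl S v x) = g (A.incl S v x))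
    (he : ∀ y, f (A.edge S y) = g (A.edge S y)) : f = g := by
  refine QuotientGroup.monoidHom_ext _ (QuotientGroup.monoidHom_ext _
    (Monoid.Coprod.hom_ext (FreeGroup.ext_hom _ _ fun y => he y) ?_))
  exact Monoid.CoprodI.ext_hom _ _ fun v => MonoidHom.ext fun x => hv v x

theorem eq_top_of_generators_mem {K : Subgroup (A.FundGroup S)} (hv : ∀ v x, A.incl S v x ∈ K)
    (he : ∀ y, A.edge S y ∈ K) : K = ⊤ := by
  refine (Subgroup.eq_top_iff' K).2 fun x => ?_
  obtain ⟨x, rfl⟩ := QuotientGroup.mk'_surjective _ x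
  obtain ⟨x, rfl⟩ := QuotientGroup.mk'_surjective _ x
  induction x using Monoid.Coprod.induction_on with
  | inl m =>
    induction m using FreeGroup.induction_on with
    | C1 => simp only [map_one]; exact K.one_mem
    | of y => exact he y
    | inv_of y h => simp only [map_inv]; exact K.inv_mem h
    | mul x y hx hy => simp only [map_mul]; exact K.mul_mem hx hy
  | inr n =>
    induction n using Monoid.CoprodI.induction_on with
    | one => simp only [map_one]; exact K.one_mem
    | of i x => exact hv i x
    | mul x y hx hy => simp only [map_mul]; exact K.mul_mem hx hy
  | mul x y hx hy => simp only [map_mul]; exact K.mul_mem hx hy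

theorem edge_of_mem {y : Y.E} (hy : y ∈ S) : A.edge S y = 1 :=
  (QuotientGroup.eq_one_iff _).2 (Subgroup.subset_normalClosure ⟨y, hy, rfl⟩)

variable (A S)

/-! ### Vertices and edges of the Bass–Serre tree -/

/-- The vertex `γ G_v`. -/
def vtx (v : Y.V) (γ : A.FundGroup S) : (A.bassSerreTree S).V := ⟨v, QuotientGroup.mk γ⟩

/-- The edge `γ G_y`. -/
def edg (y : Y.E) (γ : A.FundGroup S) : (A.bassSerreTree S).E := ⟨y, QuotientGroup.mk γ⟩

variable {A S}

theorem t_edg (y : Y.E) (γ : A.FundGroup S) :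
    (A.bassSerreTree S).t (A.edg S y γ) = A.vtx S (Y.t y) γ := rfl

theorem bar_edg (y : Y.E) (γ : A.FundGroup S) :
    (A.bassSerreTree S).bar (A.edg S y γ) = A.edg S (Y.bar y) (γ * (A.edge S y)⁻¹) := rfl

theorem o_edg (y : Y.E) (γ : A.FundGroup S) :
    (A.bassSerreTree S).o (A.edg S y γ) = A.vtx S (Y.o y) (γ * (A.edge S y)⁻¹) := rfl

theorem treeAction_vtx (v : Y.V) (γ δ : A.FundGroup S) :
    (A.treeAction S γ).onV (A.vtx S v δ) = A.vtx S v (γ * δ) := rfl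

theorem vtx_eq_iff {v : Y.V} {γ δ : A.FundGroup S} :
    A.vtx S v γ = A.vtx S v δ ↔ ∃ x, γ * A.incl S v x = δ := by
  have h : A.vtx S v γ = A.vtx S v δ ↔
      (QuotientGroup.mk γ : A.FundGroup S ⧸ A.vSub S v) = QuotientGroup.mk δ :=
    ⟨fun h => eq_of_heq (Sigma.mk.inj h).2, fun h => congrArg (Sigma.mk v) h⟩
  rw [h, QuotientGroup.eq]
  simp only [vSub, MonoidHom.mem_range, eq_inv_mul_iff_mul_eq]

theorem vtx_mul_incl (v : Y.V) (γ : A.FundGroup S) (x : A.Gv v) :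
    A.vtx S v (γ * A.incl S v x) = A.vtx S v γ :=
  (vtx_eq_iff.2 ⟨x, rfl⟩).symm

theorem edg_mul_incl (y : Y.E) (γ : A.FundGroup S) (x : A.Ge (Y.toU y)) :
    A.edg S y (γ * A.incl S _ (A.φ y rfl x)) = A.edg S y γ := by
  refine congrArg (Sigma.mk y) (QuotientGroup.eq.2 ?_)
  exact ⟨x⁻¹, by simp⟩

theorem exists_vtx (x : (A.bassSerreTree S).V) : ∃ v γ, A.vtx S v γ = x := by
  obtain ⟨v, x⟩ := x
  obtain ⟨γ, rfl⟩ := QuotientGroup.mk_surjective x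
  exact ⟨v, γ, rfl⟩

theorem exists_edg (x : (A.bassSerreTree S).E) : ∃ y γ, A.edg S y γ = x := by
  obtain ⟨v, x⟩ := x
  obtain ⟨γ, rfl⟩ := QuotientGroup.mk_surjective x
  exact ⟨v, γ, rfl⟩

/-- The Bass–Serre tree is connected. -/
theorem bassSerreTree_propagates (hS : Y.IsMaximalTree S) : (A.bassSerreTree S).Propagates := by
  intro p hp
  have hiff : ∀ e, p ((A.bassSerreTree S).o e) ↔ p ((A.bassSerreTree S).t e) := fun e =>
    ⟨hp e, fun h => by
      have := hp ((A.bassSerreTree S).bar e)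
      rw [← SerreGraph.t_eq_o_bar] at this
      exact this h⟩
  obtain ⟨hbar, htree⟩ := hS
  -- The edges `γ G_y` with `y ∈ S` form a translate of the maximal tree, which joins all the
  -- vertices `γ G_v` for fixed `γ`.
  have hconst : ∀ γ v w, p (A.vtx S v γ) → p (A.vtx S w γ) := fun γ v w =>
    htree.toIsConnected.propagates (fun v : Y.V => p (A.vtx S v γ)) (fun e he => by
      have h := hp (A.edg S e.1 γ)
      rw [o_edg, edge_of_mem e.2, inv_one, mul_one] at h
      exact h he) v w
  have hconst' : ∀ γ v w, p (A.vtx S v γ) ↔ p (A.vtx S w γ) := fun γ v w =>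
    ⟨hconst γ v w, hconst γ w v⟩
  have hP : ∀ v γ, (p (A.vtx S v γ) ↔ p (A.vtx S v 1)) := by
    intro v
    -- Quantifying over all `δ` makes this a subgroup, so generators suffice: an element of `G_w` on
    -- the right fixes the coset `δ G_w`, and the edge `δ y G_y` joins `δ G_(o y)` to `δ y G_(t y)`.
    let K : Subgroup (A.FundGroup S) :=
      { carrier := {γ | ∀ δ, p (A.vtx S v (δ * γ)) ↔ p (A.vtx S v δ)}
        one_mem' := fun δ => by rw [mul_one]
        mul_mem' := fun {γ γ'} h h' δ => by rw [← mul_assoc, h', h]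
        inv_mem' := fun {γ} h δ => by rw [← h, inv_mul_cancel_right] }
    have hK : K = ⊤ := by
      refine eq_top_of_generators_mem (fun w x δ => ?_) (fun y δ => ?_)
      · rw [hconst' _ v w, vtx_mul_incl, hconst' _ w v]
      · have h := hiff (A.edg S y (δ * A.edge S y))
        rw [o_edg, t_edg, mul_inv_cancel_right] at h
        rw [hconst' _ v (Y.t y), ← h, hconst' _ (Y.o y) v]
    intro γ
    have h : γ ∈ K := hK ▸ Subgroup.mem_top γ
    simpa using h 1
  intro u w hu
  obtain ⟨u, γ, rfl⟩ := exists_vtx u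
  obtain ⟨w, δ, rfl⟩ := exists_vtx w
  rw [hP, hconst' _ w u, ← hP u γ]
  exact hu

/-- A subgroup that meets no conjugate of a vertex group acts freely on the vertices. -/
theorem free_of_storing {G : Type*} [Group G] {χ : A.FundGroup S →* G} (hχ : A.IsStoring χ) :
    ∀ γ ∈ χ.ker, ∀ x, (A.treeAction S γ).onV x = x → γ = 1 := by
  intro γ hγ x hx
  obtain ⟨v, δ, rfl⟩ := exists_vtx x
  rw [treeAction_vtx, eq_comm, vtx_eq_iff] at hx
  obtain ⟨g, hg⟩ := hx
  have h1 : χ (A.incl S v g) = 1 := by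
    have := congrArg χ hg
    rw [map_mul, map_mul, MonoidHom.mem_ker.1 hγ, one_mul] at this
    exact mul_eq_left.1 this
  have h2 : g = 1 := hχ.injective v (by simpa using h1)
  rw [h2, map_one, mul_one] at hg
  exact (right_eq_mul.1 hg)

/-! ### A potential on the Bass–Serre tree -/

section Potential

variable (A S)

/-- The action of the fundamental group on the `1`-chains of the Bass–Serre tree. -/
noncomputable def chainRep : A.FundGroup S →* Module.End ℤ (A.bassSerreTree S).C1 :=
  (A.bassSerreTree S).endC1.comp (A.treeAction S)

variable {A S}

theorem chainRep_edgeClass (γ δ : A.FundGroup S) (y : Y.E) :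
    A.chainRep S γ ((A.bassSerreTree S).edgeClass (A.edg S y δ)) =
      (A.bassSerreTree S).edgeClass (A.edg S y (γ * δ)) :=
  SerreGraph.endC1_edgeClass _ _ _

/-- A family of `1`-chains `c v` running from a base point to the vertices `1 G_v` inside the
lift of the maximal tree. -/
theorem exists_treePotential (hS : Y.IsMaximalTree S) :
    ∃ c : Y.V → (A.bassSerreTree S).C1, ∀ y ∈ S,
      c (Y.t y) - c (Y.o y) = (A.bassSerreTree S).edgeClass (A.edg S y 1) := by
  obtain ⟨hbar, htree⟩ := hS
  obtain ⟨c, hc⟩ := htree.exists_potential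
    (fun e => (A.bassSerreTree S).edgeClass (A.edg S e.1 1)) (fun e => by
      rw [← SerreGraph.edgeClass_bar, bar_edg, edge_of_mem e.2, inv_one, mul_one]
      rfl)
  exact ⟨c, fun y hy => hc ⟨y, hy⟩⟩

/-- There is a crossed homomorphism `d` with `d γ` a chain from the base point to its translate. -/
theorem exists_crossedHom (c : Y.V → (A.bassSerreTree S).C1) (hc : ∀ y ∈ S,
      c (Y.t y) - c (Y.o y) = (A.bassSerreTree S).edgeClass (A.edg S y 1)) :
    ∃ d : A.FundGroup S → (A.bassSerreTree S).C1,
      (∀ γ δ, d (γ * δ) = d γ + A.chainRep S γ (d δ)) ∧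
      (∀ v x, d (A.incl S v x) = c v - A.chainRep S (A.incl S v x) (c v)) ∧
      ∀ y, d (A.edge S y) =
        c (Y.o y) + (A.bassSerreTree S).edgeClass (A.edg S y (A.edge S y)) -
          A.chainRep S (A.edge S y) (c (Y.t y)) := by
  -- A crossed homomorphism is the left component of a homomorphic section `π → C₁ ⋊ π`, which can
  -- be prescribed on generators.
  let Θ := mulAutOfRep (A.chainRep S)
  let N := Multiplicative (A.bassSerreTree S).C1
  let inl : N →* N ⋊[Θ] A.FundGroup S := SemidirectProduct.inl
  let inr : A.FundGroup S →* N ⋊[Θ] A.FundGroup S := SemidirectProduct.inr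
  let C : Y.V → N := fun v => Multiplicative.ofAdd (c v)
  let E : Y.E → N := fun y =>
    Multiplicative.ofAdd ((A.bassSerreTree S).edgeClass (A.edg S y (A.edge S y)))
  -- The path to `G_v` followed by the return along its `x`-translate: `x` fixes the vertex `G_v`.
  let f : ∀ v, A.Gv v →* N ⋊[Θ] A.FundGroup S := fun v =>
    (MulAut.conj (inl (C v))).toMonoidHom.comp (inr.comp (A.incl S v))
  have hf : ∀ v x, f v x = inl (C v) * inr (A.incl S v x) * (inl (C v))⁻¹ := fun _ _ => rfl
  -- The edge `y G_y` runs from `G_(o y)` to `y G_(t y)`: go to its origin, cross it, and return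
  -- along the `y`-translate of the path to `G_(t y)`.
  let g : Y.E → N ⋊[Θ] A.FundGroup S := fun y =>
    inl (C (Y.o y)) * inl (E y) * inr (A.edge S y) * (inl (C (Y.t y)))⁻¹
  have haut : ∀ γ n, inr γ * inl n = inl (Θ γ n) * inr γ := fun γ n => by
    rw [SemidirectProduct.inl_aut]; simp [inl, inr]
  -- The edge group stabilizes its edge, because `φ_(bar y)(a) y = y φ_y(a)`.
  have hE : ∀ y (a : A.Ge (Y.toU y)),
      Θ (A.incl S _ (A.φ (Y.bar y) (Y.toU_bar y) a)) (E y) = E y := fun y a => by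
    refine congrArg Multiplicative.ofAdd ((chainRep_edgeClass _ _ _).trans ?_)
    rw [← edge_conj, inv_mul_cancel_right, edg_mul_incl]
  -- Translated by `y⁻¹`, the edge `y G_y` becomes `1 G_y`, whose inverse is the edge `y⁻¹ G_(bar
  -- y)`.
  have hEbar : ∀ y, E (Y.bar y) * Θ (A.edge S y)⁻¹ (E y) = 1 := fun y => by
    have h : A.chainRep S (A.edge S y)⁻¹
        ((A.bassSerreTree S).edgeClass (A.edg S y (A.edge S y))) = _ := chainRep_edgeClass _ _ _
    refine congrArg Multiplicative.ofAdd (?_ :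
      (A.bassSerreTree S).edgeClass (A.edg S (Y.bar y) (A.edge S (Y.bar y))) +
      A.chainRep S (A.edge S y)⁻¹
        ((A.bassSerreTree S).edgeClass (A.edg S y (A.edge S y))) = 0)
    rw [h, inv_mul_cancel, ← eq_neg_iff_add_eq_zero, ← SerreGraph.edgeClass_bar, bar_edg, one_mul,
      edge_bar]
  have hconj : ∀ y (a : A.Ge (Y.toU y)),
      g y * f _ (A.φ y rfl a) * (g y)⁻¹ = f _ (A.φ (Y.bar y) (Y.toU_bar y) a) := fun y a => by
    have h1 := haut (A.incl S _ (A.φ (Y.bar y) (Y.toU_bar y) a)) (E y)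
    rw [hE, ← edge_conj] at h1
    rw [hf, hf, ← edge_conj]
    have h2 : g y * (inl (C (Y.t y)) * inr (A.incl S (Y.t y) (A.φ y rfl a)) *
        (inl (C (Y.t y)))⁻¹) * (g y)⁻¹ = inl (C (Y.o y)) * (inl (E y) *
        inr (A.edge S y * A.incl S (Y.t y) (A.φ y rfl a) * (A.edge S y)⁻¹)) * (inl (E y))⁻¹ *
        (inl (C (Y.o y)))⁻¹ := by
      simp only [g, map_mul, map_inv]
      group
    rw [h2, ← h1]
    simp only [mul_assoc, mul_inv_cancel_left]
    rfl
  have hbar : ∀ y, g (Y.bar y) * g y = 1 := fun y => by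
    have h1 := haut (A.edge S y)⁻¹ (E y)
    have ho : Y.o (Y.bar y) = Y.t y := (Y.t_eq_o_bar y).symm
    have ht : Y.t (Y.bar y) = Y.o y := rfl
    have h2 : g (Y.bar y) * g y = inl (C (Y.t y)) * inl (E (Y.bar y)) *
        (inr (A.edge S y)⁻¹ * inl (E y)) * inr (A.edge S y) * (inl (C (Y.t y)))⁻¹ := by
      simp only [g, ho, ht, edge_bar]
      group
    have h3 : inl (E (Y.bar y)) * inl (Θ (A.edge S y)⁻¹ (E y)) = 1 := by
      rw [← map_mul, hEbar, map_one]
    rw [h2, h1]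
    calc _ = inl (C (Y.t y)) * (inl (E (Y.bar y)) * inl (Θ (A.edge S y)⁻¹ (E y))) *
          (inr (A.edge S y)⁻¹ * inr (A.edge S y)) * (inl (C (Y.t y)))⁻¹ := by group
      _ = 1 := by rw [h3, ← map_mul, inv_mul_cancel, map_one, mul_one, mul_one, mul_inv_cancel]
  -- This relation is where `c` must be a potential along the maximal tree.
  have hgS : ∀ y ∈ S, g y = 1 := fun y hy => by
    have h : C (Y.o y) * E y = C (Y.t y) := by
      refine congrArg Multiplicative.ofAdd (?_ : c (Y.o y) +
        (A.bassSerreTree S).edgeClass (A.edg S y (A.edge S y)) = c (Y.t y))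
      rw [edge_of_mem hy, ← hc y hy, add_sub_cancel]
    simp only [g]
    rw [← map_mul, h, edge_of_mem hy, map_one, mul_one, mul_inv_cancel]
  let Φ := A.liftFund S f g hconj hbar hgS
  have hright : ∀ γ, (Φ γ).right = γ := fun γ => by
    have : SemidirectProduct.rightHom.comp Φ = MonoidHom.id _ :=
      fundGroup_hom_ext (fun v x => by
        change (Φ (A.incl S v x)).right = _
        simp [Φ, liftFund_incl, hf, inl, inr]) (fun y => by
        change (Φ (A.edge S y)).right = _
        simp [Φ, liftFund_edge, g, inl, inr])
    exact DFunLike.congr_fun this γ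
  refine ⟨fun γ => (Φ γ).left.toAdd, fun γ δ => ?_, fun v x => ?_, fun y => ?_⟩
  · change (Φ (γ * δ)).left.toAdd = _
    rw [map_mul, SemidirectProduct.mul_left, hright]
    rfl
  · have h : Φ (A.incl S v x) = inl (C v * (Θ (A.incl S v x) (C v))⁻¹) * inr (A.incl S v x) := by
      rw [map_mul, map_inv]
      simp only [Φ, liftFund_incl, hf]
      rw [mul_assoc, mul_assoc]
      congr 1
      rw [← map_inv, haut, map_inv, map_inv]
    simp only [h]
    rw [sub_eq_add_neg]
    simp [inl, inr]
    rfl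
  · have h : Φ (A.edge S y) = inl (C (Y.o y) * E y * (Θ (A.edge S y) (C (Y.t y)))⁻¹) *
        inr (A.edge S y) := by
      rw [map_mul, map_mul, map_inv]
      simp only [Φ, liftFund_edge, g]
      rw [mul_assoc _ (inl (Θ _ _))⁻¹, mul_assoc _ (inr _)]
      congr 1
      rw [← map_inv, haut, map_inv, map_inv]
    simp only [h]
    rw [sub_eq_add_neg]
    simp [inl, inr]
    rfl

/-- The Bass–Serre tree has a potential, that is, its first cohomology vanishes. -/
theorem exists_potential (hS : Y.IsMaximalTree S) :
    ∃ b : (A.bassSerreTree S).V → (A.bassSerreTree S).C1, ∀ e,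
      b ((A.bassSerreTree S).t e) - b ((A.bassSerreTree S).o e) =
        (A.bassSerreTree S).edgeClass e := by
  obtain ⟨c, hc⟩ := exists_treePotential (A := A) hS
  obtain ⟨d, hmul, hv, he⟩ := exists_crossedHom c hc
  have hd : ∀ x y γ, x * y = γ → d γ = d x + A.chainRep S x (d y) := by
    rintro x y _ rfl
    exact hmul x y
  let b : (A.bassSerreTree S).V → (A.bassSerreTree S).C1 := fun x =>
    d x.2.out + A.chainRep S x.2.out (c x.1)
  -- Independence of the representative: replacing `γ` by `γ x` adds `γ (c_v - x c_v)` to `d γ`, and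
  -- exactly this is lost from `γ c_v`.
  have hb : ∀ v γ, b (A.vtx S v γ) = d γ + A.chainRep S γ (c v) := by
    intro v γ
    obtain ⟨x, hx⟩ := vtx_eq_iff.1
      (congrArg (Sigma.mk v) (QuotientGroup.out_eq' (QuotientGroup.mk γ : _ ⧸ A.vSub S v)) :
        A.vtx S v (Quotient.out (QuotientGroup.mk γ : _ ⧸ A.vSub S v)) = A.vtx S v γ)
    change d (Quotient.out (QuotientGroup.mk γ : _ ⧸ A.vSub S v)) +
      A.chainRep S (Quotient.out (QuotientGroup.mk γ : _ ⧸ A.vSub S v)) (c v) = _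
    generalize Quotient.out (QuotientGroup.mk γ : _ ⧸ A.vSub S v) = δ at hx ⊢
    rw [← hx, hmul, hv, map_sub, map_mul, Module.End.mul_apply]
    abel
  refine ⟨b, fun e => ?_⟩
  obtain ⟨y, γ, rfl⟩ := exists_edg e
  -- With `γ = δ y` the origin is `δ G_(o y)`, and the formula for `d y` leaves only `δ [y G_y]`.
  obtain ⟨δ, rfl⟩ : ∃ δ, δ * A.edge S y = γ := ⟨γ * (A.edge S y)⁻¹, by simp⟩
  rw [t_edg, o_edg, hb, hb, mul_inv_cancel_right, hmul, he, map_sub, map_add, map_mul,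
    Module.End.mul_apply, chainRep_edgeClass]
  abel

end Potential

end GraphOfGroups

theorem lemma3p1 {Y : SerreGraph} (A : GraphOfGroups Y) (S : Set Y.E) (hS : Y.IsMaximalTree S)
    {G : Type*} [Group G] [Finite G] (χ : A.FundGroup S →* G) (hχ : A.IsStoring χ) :
    Nonempty ((kerAbRep χ hχ.surjective).asModule ≃ₗ[MonoidAlgebra ℤ G]
      (A.h1Rep χ hχ.surjective).asModule) := by
  obtain ⟨b, hb⟩ := GraphOfGroups.exists_potential (A := A) hS
  obtain ⟨v⟩ := A.connected.nonempty
  have hT := GraphOfGroups.bassSerreTree_propagates (A := A) hS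
  let e : Additive (Abelianization χ.ker) ≃ₗ[ℤ] (A.quotientGraph χ).H1 :=
    abelianizationEquivH1 (A.treeAction S) (A.treeAction_withoutInversions S) χ.ker b hb hT
      (GraphOfGroups.free_of_storing hχ) (A.vtx S v 1)
  -- As `χ` is onto, equivariance under `G` reduces to equivariance under `π`.
  have he : ∀ g, e.toLinearMap ∘ₗ kerAbRep χ hχ.surjective g =
      A.h1Rep χ hχ.surjective g ∘ₗ e.toLinearMap := by
    intro g
    obtain ⟨γ, rfl⟩ := hχ.surjective g
    refine LinearMap.ext fun z => ?_
    have h1 : kerAbRep χ hχ.surjective (χ γ) = conjAb χ.ker γ := descend_apply _ _ _ _ _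
    have h2 : A.quotientAction χ hχ.surjective (χ γ) = _ := descend_apply _ _ _ _ _
    change e (kerAbRep χ hχ.surjective (χ γ) z) =
      SerreGraph.endH1 _ (A.quotientAction χ hχ.surjective (χ γ)) (e z)
    rw [h1, h2]
    exact pathLinear_conjAb (A.treeAction S) (A.treeAction_withoutInversions S) χ.ker b hb hT
      (A.vtx S v 1) γ z
  let E := Representation.Equiv.mk e he
  let F := Representation.IntertwiningMap.equivLinearMapAsModule _ _ E.toIntertwiningMap
  exact ⟨LinearEquiv.ofBijective F e.bijective⟩
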